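/- Let $(M,g)$ be a compact smooth three-dimensional Riemannian manifold without boundary, with Laplace–Beltrami operator $\Delta$. For $s\in\mathbb R$ let $H^s(M)$ be the Sobolev space of real distributions $u$ on $M$ with $(1-\Delta)^{s/2}u\in L^2(M)$. Let $e_n\in C^\infty(M)$, $n\ge 1$, be an orthonormal basis of $L^2(M)$ consisting of real eigenfunctions of $-\Delta$, $-\Delta e_n=\lambda_n^2e_n$. Let $s\in\mathbb R$, $\varepsilon>0$, $\alpha_n\in\mathbb R$, and let $$f=\sum_{n=1}^\infty \alpha_n e_n\in H^s(M),\qquad f\notin H^{s+\varepsilon}(M),$$ where the series converges in the sense of distributions. Let $(l_n)_{n\ge1}$ be a sequence of independent real random variables on a probability space $(\Omega,\mathcal A,p)$. 1. If there is a $c>0$ such that $\limsup_{n\to\infty}p(\{|l_n|\le c\})<1$, then the randomized series $f^\omega=\sum_{n=1}^\infty l_n(\omega)\alpha_n e_n$ belongs to $H^{s+\varepsilon}(M)$ with probability zero; that is, the set of all $\omega$ for which the series converges in the sense of distributions to an element of $H^{s+\varepsilon}(M)$ has probability zero. 2. The assumption of 1 (the existence of such a $c$) holds if the $l_n$ are identically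 distributed and not almost surely zero. -/

import Mathlib

open Bundle MeasureTheory ProbabilityTheory Filter Topology Manifold
open scoped ContDiff

noncomputable section

namespace RiemannSobolev

/-! `M` is a smooth `d`-dimensional manifold without boundary with a Riemannian metric: an inner
product on each tangent space (its smoothness is assumed in the theorem). -/

variable {d : ℕ} {M : Type*} [TopologicalSpace M] [ChartedSpace (EuclideanSpace ℝ (Fin d)) M]
  [RiemannianBundle (fun x : M => TangentSpace (𝓡 d) x)]

/-- The Gram matrix `(g_ij)` of the metric in the chart at `x`, at the point `z` of the range of
that chart: the inner products of the coordinate vector fields `∂_i`, `∂_j`. -/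
def chartGram (x : M) (z : EuclideanSpace ℝ (Fin d)) : Matrix (Fin d) (Fin d) ℝ :=
  Matrix.of fun i j =>
    inner ℝ
      (mfderiv 𝓘(ℝ, EuclideanSpace ℝ (Fin d)) (𝓡 d) (extChartAt (𝓡 d) x).symm z
        (EuclideanSpace.single i (1 : ℝ)))
      (mfderiv 𝓘(ℝ, EuclideanSpace ℝ (Fin d)) (𝓡 d) (extChartAt (𝓡 d) x).symm z
        (EuclideanSpace.single j (1 : ℝ)))

/-- The measure `√(det g_ij) dz` of the chart at `x`, carried over to the domain of the chart and
extended by zero outside of it. -/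
def chartVolume [MeasurableSpace M] (x : M) : Measure M :=
  Measure.map (extChartAt (𝓡 d) x).symm
    ((volume.restrict (extChartAt (𝓡 d) x).target).withDensity
      fun z => ENNReal.ofReal (√(chartGram x z).det))

variable (d M) in
/-- The Riemannian volume measure. By the change of variables formula the measures `chartVolume x`
and `chartVolume y` coincide on the intersection of the domains of the two charts, so their
supremum in the lattice of measures is the measure on `M` that is `√(det g_ij) dz` in every
chart. -/
def riemannianVolume [MeasurableSpace M] : Measure M :=
  ⨆ x : M, chartVolume (d := d) x

/-- The gradient of `φ` at `x`: the tangent vector that represents the differential of `φ` at `x`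
with respect to the inner product of the tangent space. -/
def gradient (φ : C^∞⟮𝓡 d, M; ℝ⟯) (x : M) : TangentSpace (𝓡 d) x :=
  haveI : FiniteDimensional ℝ (TangentSpace (𝓡 d) x) :=
    inferInstanceAs (FiniteDimensional ℝ (EuclideanSpace ℝ (Fin d)))
  haveI : CompleteSpace (TangentSpace (𝓡 d) x) := FiniteDimensional.complete ℝ _
  (InnerProductSpace.toDual ℝ (TangentSpace (𝓡 d) x)).symm (mfderiv (𝓡 d) 𝓘(ℝ, ℝ) φ x)

variable [MeasurableSpace M]

/-- `IsLaplacian φ ψ`: the Laplace-Beltrami operator maps `φ` to `ψ`, that is,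
`∫ ⟨∇φ, ∇χ⟩ = -∫ ψ χ` for every test function `χ` (`M` is compact without boundary). -/
def IsLaplacian (φ ψ : C^∞⟮𝓡 d, M; ℝ⟯) : Prop :=
  ∀ χ : C^∞⟮𝓡 d, M; ℝ⟯,
    ∫ x, inner ℝ (gradient φ x) (gradient χ x) ∂(riemannianVolume d M) =
      -∫ x, ψ x * χ x ∂(riemannianVolume d M)

/-- `-Δ φ = μ φ` with `φ` smooth and in `L²(M)` (every smooth function is, when `M` is
compact). -/
def IsEigenfunction (φ : C^∞⟮𝓡 d, M; ℝ⟯) (μ : ℝ) : Prop :=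
  MemLp φ 2 (riemannianVolume d M) ∧ IsLaplacian φ (-(μ • φ))

/-- `(e n)` is an orthonormal basis of the real space `L²(M)` that consists of smooth
eigenfunctions of `-Δ`, with eigenvalues `(lam n)²`. -/
structure IsEigenbasis (e : ℕ → C^∞⟮𝓡 d, M; ℝ⟯) (lam : ℕ → ℝ) : Prop where
  eigen : ∀ n, IsEigenfunction (e n) (lam n ^ 2)
  basis : ∃ b : HilbertBasis ℕ ℝ (Lp ℝ 2 (riemannianVolume d M)),
    ∀ n, (b n : M → ℝ) =ᵐ[riemannianVolume d M] e n

/-- A linear functional on `C^∞(M)` is a distribution (`M` compact) if it is bounded by finitely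
many of the seminorms `sup |X₁ ⋯ X_k φ|`, where the `X_j` are smooth vector fields, that is,
derivations of the algebra `C^∞(M)`. -/
def IsDistribution (u : C^∞⟮𝓡 d, M; ℝ⟯ →ₗ[ℝ] ℝ) : Prop :=
  ∃ (S : Finset (List (Derivation ℝ C^∞⟮𝓡 d, M; ℝ⟯ C^∞⟮𝓡 d, M; ℝ⟯))) (C : ℝ),
    ∀ φ : C^∞⟮𝓡 d, M; ℝ⟯,
      |u φ| ≤ C * ∑ L ∈ S, ⨆ x : M, |(L.foldr (fun X ψ => X ψ) φ) x|

/-- `(1 - Δ)^{s/2} u = g` for a distribution `u` and `g ∈ L²(M)`. The operator multiplies by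
`(1 + μ)^{s/2}` on the eigenspace of `-Δ` with eigenvalue `μ`, it is symmetric, and the linear span
of the eigenfunctions is dense in `C^∞(M)`; so the equation is tested against them. -/
def IsBesselPotential (s : ℝ) (u : C^∞⟮𝓡 d, M; ℝ⟯ →ₗ[ℝ] ℝ) (g : M → ℝ) : Prop :=
  ∀ (φ : C^∞⟮𝓡 d, M; ℝ⟯) (μ : ℝ), IsEigenfunction φ μ →
    (1 + μ) ^ (s / 2) * u φ = ∫ x, g x * φ x ∂(riemannianVolume d M)

variable (d M) in
/-- The Sobolev space `H^s(M)`, `s` real: the distributions `u` with `(1 - Δ)^{s/2} u ∈ L²(M)`. -/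
def sobolevSpace (s : ℝ) : Set (C^∞⟮𝓡 d, M; ℝ⟯ →ₗ[ℝ] ℝ) :=
  {u | IsDistribution u ∧
    ∃ g : M → ℝ, MemLp g 2 (riemannianVolume d M) ∧ IsBesselPotential s u g}

/-- `u = ∑ a_n e_n`: the partial sums of the series, as distributions `φ ↦ ∑ a_n ∫ e_n φ`, converge
to `u` in the sense of distributions. -/
def IsDistribSum (a : ℕ → ℝ) (e : ℕ → C^∞⟮𝓡 d, M; ℝ⟯) (u : C^∞⟮𝓡 d, M; ℝ⟯ →ₗ[ℝ] ℝ) : Prop :=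
  ∀ φ : C^∞⟮𝓡 d, M; ℝ⟯,
    Tendsto (fun N => ∑ n ∈ Finset.range N, a n * ∫ x, e n x * φ x ∂(riemannianVolume d M))
      atTop (𝓝 (u φ))

end RiemannSobolev
end

open Bundle MeasureTheory ProbabilityTheory Filter Topology Manifold
open scoped ContDiff

/-! ### Almost sure divergence of random series with nonnegative terms. -/

section Probability

variable {Ω : Type*} [MeasurableSpace Ω] {p : Measure Ω}

/-! For a distribution with coefficients `a n` in the eigenbasis, membership in `H^σ` means `∑ (1 +
λ_n²)^σ a_n² < ∞` (`mem_sobolevSpace_of_summable`, `summable_of_mem_sobolevSpace`). So with `A_n =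
(1 + λ_n²)^(s+ε) α_n²` the series `∑ A_n` diverges, and `∑ A_n l_n²` has to diverge almost surely
(`measure_summable_mul_sq_eq_zero`). By independence `E exp(-∑ A_n l_n²)` is the product of the `E
exp(-A_n l_n²)`. For large `n`, `|l_n| > c` has probability at least `δ`, so the factor is at most
`exp(-δ (1 - exp(-A_n c²)))`. These exponents sum to `-∞` because `∑ A_n` diverges; hence the
expectation is zero. -/

/-- If `∑ x n` diverges for a nonnegative sequence, so does `∑ (1 - exp (-x n))`. -/
theorem summable_of_summable_one_sub_exp_neg {x : ℕ → ℝ} (hx : ∀ n, 0 ≤ x n)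
    (h : Summable fun n => 1 - Real.exp (-x n)) : Summable x := by
  have hlim : Tendsto (fun n => 1 - Real.exp (-x n)) atTop (𝓝 0) := h.tendsto_atTop_zero
  have hev : ∀ᶠ n in atTop, 1 - Real.exp (-x n) < 1 / 2 := hlim.eventually_lt_const (by norm_num)
  -- Once `exp(-x) > 1/2`, we have `x ≤ exp x - 1 = exp x * (1 - exp(-x)) ≤ 2 (1 - exp(-x))`.
  refine Summable.of_norm_bounded_eventually_nat (h.mul_left 2) ?_
  filter_upwards [hev] with n hn
  rw [Real.norm_of_nonneg (hx n)]
  have h1 : Real.exp (-x n) * Real.exp (x n) = 1 := by rw [← Real.exp_add]; simp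
  have h2 : x n + 1 ≤ Real.exp (x n) := Real.add_one_le_exp _
  nlinarith [Real.exp_pos (-x n), hx n]

/-- A random variable that exceeds `c` in absolute value with probability at least `δ` has
`E exp (-a l²) ≤ exp (-δ (1 - exp (-a c²)))`. -/
theorem integral_exp_neg_mul_sq_le [IsProbabilityMeasure p] {l : Ω → ℝ} (hl : Measurable l)
    {a c δ : ℝ} (ha : 0 ≤ a) (hc : 0 < c) (hδ : δ ≤ p.real {w | c < |l w|}) :
    ∫ w, Real.exp (-(a * l w ^ 2)) ∂p ≤ Real.exp (-(δ * (1 - Real.exp (-(a * c ^ 2))))) := by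
  have hmeas : MeasurableSet {w | c < |l w|} := measurableSet_lt measurable_const hl.abs
  set t := 1 - Real.exp (-(a * c ^ 2)) with ht
  have ht0 : 0 ≤ t := by
    have : Real.exp (-(a * c ^ 2)) ≤ 1 := Real.exp_le_one_iff.2 (by nlinarith [sq_nonneg c])
    linarith
  have hbound : ∀ w, Real.exp (-(a * l w ^ 2)) ≤ 1 - {w | c < |l w|}.indicator (fun _ => t) w := by
    intro w
    by_cases hw : c < |l w|
    · rw [Set.indicator_of_mem (by exact hw), ht]
      have : c ^ 2 ≤ l w ^ 2 := by rw [← sq_abs (l w)]; gcongr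
      have : Real.exp (-(a * l w ^ 2)) ≤ Real.exp (-(a * c ^ 2)) := by gcongr
      linarith
    · rw [Set.indicator_of_notMem (by exact hw)]
      simpa using mul_nonneg ha (sq_nonneg (l w))
  have hind : Integrable ({w | c < |l w|}.indicator (fun _ => t)) p :=
    (integrable_const t).indicator hmeas
  calc ∫ w, Real.exp (-(a * l w ^ 2)) ∂p
      ≤ ∫ w, (1 - {w | c < |l w|}.indicator (fun _ => t) w) ∂p := by
        refine integral_mono_of_nonneg (ae_of_all _ fun w => (Real.exp_pos _).le)
          ((integrable_const 1).sub hind) (ae_of_all _ hbound)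
    _ = 1 - p.real {w | c < |l w|} * t := by
        rw [integral_sub (integrable_const 1) hind, integral_indicator_const _ hmeas]
        simp
    _ ≤ 1 - δ * t := by gcongr
    _ ≤ Real.exp (-(δ * t)) := by linarith [Real.add_one_le_exp (-(δ * t))]

/-- A random series `∑ a n (l n)²` with independent `l n` that are bounded away from zero with
probabilities bounded below diverges almost surely if `∑ a n` diverges. -/
theorem measure_summable_mul_sq_eq_zero [IsProbabilityMeasure p] {l : ℕ → Ω → ℝ}
    (hl : ∀ n, Measurable (l n)) (hindep : iIndepFun l p) {a : ℕ → ℝ} (ha : ∀ n, 0 ≤ a n)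
    (hdiv : ¬ Summable a) {c δ : ℝ} (hc : 0 < c) (hδ : 0 < δ)
    (hlow : ∀ᶠ n in atTop, δ ≤ p.real {w | c < |l n w|}) :
    p {w | Summable fun n => a n * l n w ^ 2} = 0 := by
  obtain ⟨N, hN⟩ := eventually_atTop.1 hlow
  -- Shifting by `N` makes the lower bound `δ` valid for every factor and does not affect
  -- summability.
  set F : ℕ → Ω → ℝ := fun k w => Real.exp (-(a (k + N) * l (k + N) w ^ 2)) with hF
  have hFm : ∀ k, Measurable (F k) := fun k => by have := hl (k + N); fun_prop
  have hFind : iIndepFun F p := by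
    have h1 : iIndepFun (fun k => l (k + N)) p := hindep.precomp (add_left_injective N)
    exact h1.comp (fun k x => Real.exp (-(a (k + N) * x ^ 2))) (fun k => by fun_prop)
  set t : ℕ → ℝ := fun k => 1 - Real.exp (-(a (k + N) * c ^ 2)) with ht
  have ht0 : ∀ k, 0 ≤ t k := fun k => by
    have : Real.exp (-(a (k + N) * c ^ 2)) ≤ 1 :=
      Real.exp_le_one_iff.2 (by nlinarith [ha (k + N), sq_nonneg c])
    simp only [ht]; linarith
  have htdiv : ¬ Summable t := fun h => by
    have h1 := summable_of_summable_one_sub_exp_neg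
      (x := fun k => a (k + N) * c ^ 2) (fun k => mul_nonneg (ha _) (sq_nonneg c)) h
    have h2 : Summable fun k => a (k + N) :=
      (summable_mul_right_iff (pow_ne_zero 2 hc.ne')).1 h1
    exact hdiv ((summable_nat_add_iff N).1 h2)
  have hprod : ∀ n, ∫⁻ w, ENNReal.ofReal (∏ k ∈ Finset.range n, F k w) ∂p
      ≤ ENNReal.ofReal (Real.exp (-(δ * ∑ k ∈ Finset.range n, t k))) := by
    intro n
    have hle : ∀ w, ∏ k ∈ Finset.range n, F k w ≤ 1 := fun w =>
      Finset.prod_le_one (fun k _ => (Real.exp_pos _).le) fun k _ =>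
        Real.exp_le_one_iff.2 (neg_nonpos.2 (mul_nonneg (ha _) (sq_nonneg _)))
    have hpos : ∀ w, 0 ≤ ∏ k ∈ Finset.range n, F k w := fun w =>
      Finset.prod_nonneg fun k _ => (Real.exp_pos _).le
    have hint : Integrable (fun w => ∏ k ∈ Finset.range n, F k w) p := by
      refine Integrable.of_bound (Finset.measurable_fun_prod _ fun k _ => hFm k).aestronglyMeasurable
        1 (ae_of_all _ fun w => ?_)
      rw [Real.norm_of_nonneg (hpos w)]; exact hle w
    rw [← ofReal_integral_eq_lintegral_ofReal hint (ae_of_all _ hpos)]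
    refine ENNReal.ofReal_le_ofReal ?_
    have h1 : ∫ w, ∏ k ∈ Finset.range n, F k w ∂p = ∏ k ∈ Finset.range n, ∫ w, F k w ∂p := by
      have h2 : iIndepFun (fun (k : Fin n) => F k) p := hFind.precomp Fin.val_injective
      have h3 := h2.integral_fun_prod_eq_prod_integral
        (fun k => (hFm k).aestronglyMeasurable)
      simpa only [Finset.prod_range] using h3
    rw [h1, Finset.mul_sum, ← Finset.sum_neg_distrib, Real.exp_sum]
    exact Finset.prod_le_prod (fun k _ => integral_nonneg fun w => (Real.exp_pos _).le)
      fun k _ => integral_exp_neg_mul_sq_le (hl _) (ha _) hc (hN _ (Nat.le_add_left N k))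
  have hlim : Tendsto (fun n => ENNReal.ofReal (Real.exp (-(δ * ∑ k ∈ Finset.range n, t k))))
      atTop (𝓝 0) := by
    have h1 := (not_summable_iff_tendsto_nat_atTop_of_nonneg ht0).1 htdiv
    have h2 := Real.tendsto_exp_neg_atTop_nhds_zero.comp (h1.const_mul_atTop hδ)
    simpa using ENNReal.tendsto_ofReal h2
  -- Fatou needs no convergence of the products, only that their expectations tend to zero.
  have hfatou : ∫⁻ w, liminf (fun n => ENNReal.ofReal (∏ k ∈ Finset.range n, F k w)) atTop ∂p = 0 := by
    refine le_antisymm ((lintegral_liminf_le fun n => ?_).trans ?_) zero_le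
    · exact (Finset.measurable_fun_prod _ fun k _ => hFm k).ennreal_ofReal
    · rw [← hlim.liminf_eq]
      exact liminf_le_liminf (Eventually.of_forall hprod)
  have hae : ∀ᵐ w ∂p, liminf (fun n => ENNReal.ofReal (∏ k ∈ Finset.range n, F k w)) atTop = 0 := by
    refine (lintegral_eq_zero_iff ?_).1 hfatou
    exact Measurable.liminf fun n =>
      (Finset.measurable_fun_prod _ fun k _ => hFm k).ennreal_ofReal
  refine measure_mono_null (fun w hw => ?_) (ae_iff.1 hae)
  have h1 : Summable fun k => a (k + N) * l (k + N) w ^ 2 :=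
    (summable_nat_add_iff N (f := fun n => a n * l n w ^ 2)).2 hw
  -- Where the series converges, the products have a positive limit, so the liminf is nonzero there.
  have h2 : Tendsto (fun n => ENNReal.ofReal (∏ k ∈ Finset.range n, F k w)) atTop
      (𝓝 (ENNReal.ofReal (Real.exp (-∑' k, a (k + N) * l (k + N) w ^ 2)))) := by
    simp only [hF, ← Real.exp_sum, Finset.sum_neg_distrib]
    exact ENNReal.tendsto_ofReal
      ((Real.continuous_exp.tendsto _).comp h1.hasSum.tendsto_sum_nat.neg)
  rw [Set.mem_ofPred_eq, h2.liminf_eq]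
  simpa using Real.exp_pos _

theorem exists_eventually_le_real_of_limsup_lt_one [IsProbabilityMeasure p] {l : ℕ → Ω → ℝ}
    (hl : ∀ n, Measurable (l n)) {c : ℝ}
    (h : limsup (fun n => p {w | |l n w| ≤ c}) atTop < 1) :
    ∃ δ : ℝ, 0 < δ ∧ ∀ᶠ n in atTop, δ ≤ p.real {w | c < |l n w|} := by
  obtain ⟨r, hr, hr1⟩ := exists_between h
  have hrt : r ≠ ⊤ := (hr1.trans ENNReal.one_lt_top).ne
  refine ⟨1 - r.toReal, ?_, ?_⟩
  · have := (ENNReal.toReal_lt_toReal hrt ENNReal.one_ne_top).2 hr1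
    simp at this; linarith
  · filter_upwards [eventually_lt_of_limsup_lt hr] with n hn
    have h1 : {w | c < |l n w|} = {w | |l n w| ≤ c}ᶜ := by ext w; simp
    rw [h1, probReal_compl_eq_one_sub (measurableSet_le (hl n).abs measurable_const)]
    have := ENNReal.toReal_mono hrt hn.le
    rw [Measure.real]; linarith

/-- The events `|l| ≤ c` shrink to `l = 0` as `c → 0`; if all had full measure, so would the
intersection over `c = 1/(n+1)`. -/
theorem exists_measure_abs_le_lt_one [IsProbabilityMeasure p] {l : Ω → ℝ} (hl : Measurable l)
    (h : ¬ l =ᵐ[p] 0) : ∃ c : ℝ, 0 < c ∧ p {w | |l w| ≤ c} < 1 := by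
  by_contra! hcon
  refine h ?_
  have hall : ∀ n : ℕ, ∀ᵐ w ∂p, |l w| ≤ 1 / ((n : ℝ) + 1) := fun n => by
    have h1 := hcon (1 / ((n : ℝ) + 1)) (by positivity)
    exact (prob_compl_eq_zero_iff (measurableSet_le hl.abs measurable_const)).2
      (le_antisymm prob_le_one h1)
  filter_upwards [ae_all_iff.2 hall] with w hw
  have := ge_of_tendsto' tendsto_one_div_add_atTop_nhds_zero_nat hw
  exact abs_nonpos_iff.1 this

end Probability

/-! ### Sobolev regularity in terms of eigenbasis coefficients. -/

namespace RiemannSobolev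

theorem inner_eq_integral_mul {M : Type*} [MeasurableSpace M] {V : Measure M} {F G : Lp ℝ 2 V} {f g : M → ℝ}
    (hf : F =ᵐ[V] f) (hg : G =ᵐ[V] g) : inner ℝ F G = ∫ x, f x * g x ∂V := by
  rw [L2.inner_def]
  refine integral_congr_ae ?_
  filter_upwards [hf, hg] with x hx hy
  simp [hx, hy, mul_comm]

variable {d : ℕ} {M : Type*} [TopologicalSpace M] [ChartedSpace (EuclideanSpace ℝ (Fin d)) M]
  [RiemannianBundle (fun x : M => TangentSpace (𝓡 d) x)] [MeasurableSpace M]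

/-- Eigenfunctions of the Laplacian for different eigenvalues are orthogonal. -/
theorem IsEigenfunction.integral_mul_eq_zero {φ ψ : C^∞⟮𝓡 d, M; ℝ⟯} {μ ν : ℝ}
    (hφ : IsEigenfunction φ μ) (hψ : IsEigenfunction ψ ν) (hne : μ ≠ ν) :
    ∫ x, φ x * ψ x ∂(riemannianVolume d M) = 0 := by
  have h1 := hφ.2 ψ
  have h2 := hψ.2 φ
  -- Symmetry of the Dirichlet form turns the two weak equations into `ν ∫ φψ = μ ∫ φψ`.
  have h3 : ∫ x, inner ℝ (gradient φ x) (gradient ψ x) ∂(riemannianVolume d M) =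
      ∫ x, inner ℝ (gradient ψ x) (gradient φ x) ∂(riemannianVolume d M) :=
    integral_congr_ae (ae_of_all _ fun x => real_inner_comm _ _)
  rw [h3, h2] at h1
  have h4 : ∀ (χ η : C^∞⟮𝓡 d, M; ℝ⟯) (r : ℝ),
      -∫ x, (-(r • χ) : C^∞⟮𝓡 d, M; ℝ⟯) x * η x ∂(riemannianVolume d M) =
        r * ∫ x, χ x * η x ∂(riemannianVolume d M) := fun χ η r => by
    rw [← integral_neg, ← integral_const_mul]
    refine integral_congr_ae (ae_of_all _ fun x => ?_)
    simp [mul_assoc]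
  rw [h4, h4] at h1
  have h5 : ∫ x, ψ x * φ x ∂(riemannianVolume d M) = ∫ x, φ x * ψ x ∂(riemannianVolume d M) := by
    simp only [mul_comm]
  rw [h5] at h1
  have h6 : (ν - μ) * ∫ x, φ x * ψ x ∂(riemannianVolume d M) = 0 := by linear_combination h1
  exact (mul_eq_zero.1 h6).resolve_left (sub_ne_zero.2 hne.symm)

variable {e : ℕ → C^∞⟮𝓡 d, M; ℝ⟯} {lam : ℕ → ℝ}

/-- The coefficients of a series in the eigenbasis are the values of its sum on the basis. -/
theorem IsEigenbasis.apply_eq_of_isDistribSum (he : IsEigenbasis e lam) {a : ℕ → ℝ}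
    {u : C^∞⟮𝓡 d, M; ℝ⟯ →ₗ[ℝ] ℝ} (hu : IsDistribSum a e u) (m : ℕ) : u (e m) = a m := by
  obtain ⟨b, hb⟩ := he.basis
  refine tendsto_nhds_unique (hu (e m)) (tendsto_const_nhds.congr' ?_)
  filter_upwards [eventually_gt_atTop m] with N hN
  have h1 : ∀ n, ∫ x, e n x * e m x ∂(riemannianVolume d M) = if n = m then 1 else 0 := fun n => by
    rw [← inner_eq_integral_mul (hb n) (hb m)]
    exact orthonormal_iff_ite.1 b.orthonormal n m
  simp [h1, hN]

/-- The coefficients of an element of `H^s` satisfy `∑ (1 + λ_n²)^s a_n² < ∞`. -/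
theorem IsEigenbasis.summable_of_mem_sobolevSpace (he : IsEigenbasis e lam) {a : ℕ → ℝ} {s : ℝ}
    {u : C^∞⟮𝓡 d, M; ℝ⟯ →ₗ[ℝ] ℝ} (hu : IsDistribSum a e u) (hus : u ∈ sobolevSpace d M s) :
    Summable fun n => ((1 + lam n ^ 2) ^ (s / 2) * a n) ^ 2 := by
  obtain ⟨-, g, hg, hgu⟩ := hus
  obtain ⟨b, hb⟩ := he.basis
  have h1 := (b.orthonormal.inner_products_summable (hg.toLp g))
  refine h1.congr fun n => ?_
  rw [inner_eq_integral_mul (hb n) hg.coeFn_toLp, ← he.apply_eq_of_isDistribSum hu n,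
    hgu _ _ (he.eigen n), Real.norm_eq_abs, sq_abs]
  simp only [mul_comm]

/-- A distribution whose coefficients satisfy `∑ (1 + λ_n²)^s a_n² < ∞` belongs to `H^s`. -/
theorem IsEigenbasis.mem_sobolevSpace_of_summable (he : IsEigenbasis e lam) {a : ℕ → ℝ} {s : ℝ}
    {u : C^∞⟮𝓡 d, M; ℝ⟯ →ₗ[ℝ] ℝ} (hu : IsDistribSum a e u) (hdist : IsDistribution u)
    (hsum : Summable fun n => ((1 + lam n ^ 2) ^ (s / 2) * a n) ^ 2) :
    u ∈ sobolevSpace d M s := by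
  obtain ⟨b, hb⟩ := he.basis
  have hmem : Memℓp (fun n => (1 + lam n ^ 2) ^ (s / 2) * a n) 2 := by
    refine memℓp_gen ?_
    simpa [mul_pow] using hsum
  set G : Lp ℝ 2 (riemannianVolume d M) :=
    b.repr.symm (⟨fun n => (1 + lam n ^ 2) ^ (s / 2) * a n, hmem⟩ : lp (fun _ : ℕ => ℝ) 2) with hG
  refine ⟨hdist, G, Lp.memLp G, fun φ μ hφ => ?_⟩
  have hφL := hφ.1.coeFn_toLp
  rw [← inner_eq_integral_mul (ae_eq_refl _) hφL]
  have h1 := (b.hasSum_inner_mul_inner G (hφ.1.toLp φ)).tendsto_sum_nat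
  refine tendsto_nhds_unique ((hu φ).const_mul ((1 + μ) ^ (s / 2))) (h1.congr fun N => ?_)
  rw [Finset.mul_sum]
  refine Finset.sum_congr rfl fun n _ => ?_
  have h2 : inner ℝ G (b n) = (1 + lam n ^ 2) ^ (s / 2) * a n := by
    rw [real_inner_comm, ← b.repr_apply_apply, hG, LinearIsometryEquiv.apply_symm_apply]
  rw [h2, inner_eq_integral_mul (hb n) hφL]
  -- The test eigenfunction `φ` need not be a basis element. Its coefficient along `e n` vanishes
  -- unless `lam n ^ 2 = μ`, so the weights at `lam n ^ 2` and `μ` agree in every surviving term.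
  by_cases hμ : lam n ^ 2 = μ
  · rw [hμ]; ring
  · rw [(he.eigen n).integral_mul_eq_zero hφ hμ]; simp

end RiemannSobolev

theorem lemmaB1 {M : Type*} [TopologicalSpace M] [T2Space M] [CompactSpace M]
    [MeasurableSpace M] [BorelSpace M]
    [ChartedSpace (EuclideanSpace ℝ (Fin 3)) M] [IsManifold (𝓡 3) ∞ M]
    [RiemannianBundle (fun x : M => TangentSpace (𝓡 3) x)]
    [IsContMDiffRiemannianBundle (𝓡 3) ∞ (EuclideanSpace ℝ (Fin 3))
      (fun x : M => TangentSpace (𝓡 3) x)]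
    (e : ℕ → C^∞⟮𝓡 3, M; ℝ⟯) (lam : ℕ → ℝ) (he : RiemannSobolev.IsEigenbasis e lam)
    (s ε : ℝ) (hε : 0 < ε) (α : ℕ → ℝ) (f : C^∞⟮𝓡 3, M; ℝ⟯ →ₗ[ℝ] ℝ)
    (hf : RiemannSobolev.IsDistribSum α e f)
    (hfs : f ∈ RiemannSobolev.sobolevSpace 3 M s)
    (hfsε : f ∉ RiemannSobolev.sobolevSpace 3 M (s + ε))
    {Ω : Type*} [MeasurableSpace Ω] (p : Measure Ω) [IsProbabilityMeasure p]
    (l : ℕ → Ω → ℝ) (hl : ∀ n, Measurable (l n)) (hindep : iIndepFun l p) :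
    ((∃ c : ℝ, 0 < c ∧ limsup (fun n => p {w | |l n w| ≤ c}) atTop < 1) →
      p {w | ∃ u ∈ RiemannSobolev.sobolevSpace 3 M (s + ε),
        RiemannSobolev.IsDistribSum (fun n => l n w * α n) e u} = 0) ∧
    ((∀ n, IdentDistrib (l n) (l 0) p p) → ¬ (l 0 =ᵐ[p] 0) →
      ∃ c : ℝ, 0 < c ∧ limsup (fun n => p {w | |l n w| ≤ c}) atTop < 1) := by
  refine ⟨?_, fun hid hne => ?_⟩
  · rintro ⟨c, hc, hlim⟩
    obtain ⟨δ, hδ, hlow⟩ := exists_eventually_le_real_of_limsup_lt_one hl hlim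
    -- Membership of `f` in `H^s` enters only through `hfs.1`: `f` is a distribution, so only the
    -- failure of summability can keep it out of `H^(s+ε)`.
    refine measure_mono_null ?_ (measure_summable_mul_sq_eq_zero hl hindep
      (a := fun n => ((1 + lam n ^ 2) ^ ((s + ε) / 2) * α n) ^ 2) (fun n => sq_nonneg _)
      (fun h => hfsε (he.mem_sobolevSpace_of_summable hf hfs.1 h)) hc hδ hlow)
    rintro w ⟨u, hu, hsum⟩
    exact (he.summable_of_mem_sobolevSpace hsum hu).congr fun n => by ring
  · obtain ⟨c, hc, hlt⟩ := exists_measure_abs_le_lt_one (hl 0) hne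
    refine ⟨c, hc, ?_⟩
    have h1 : ∀ n, p {w | |l n w| ≤ c} = p {w | |l 0 w| ≤ c} := fun n =>
      (hid n).measure_mem_eq (s := {x | |x| ≤ c})
        (measurableSet_le measurable_id.abs measurable_const)
    simpa only [h1, limsup_const] using hlt
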